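/- Consider a finite Markov decision process with finite state space $\mathcal S$ and finite action space $\mathcal A$, initial-state distribution $\iota$ with $\iota(s)>0$ for all $s$, transition distribution $\tau(s'\mid s,a)$, reward function $r(s,a,s')\in\mathbb R$ and discount factor $\gamma\in[0,1)$. Let $\pi_T(a\mid s)$ be a teacher policy and let $\alpha>0$. For a policy $\pi$, let $\bar r^{\pi}\in[-\infty,\infty)$ be the optimal value of the entropy-regularized policy evaluation problem $$\max_{d,\,p}\ \sum_{s,a}p(s,a)\sum_{s'}\tau(s'\mid s,a)\,r(s,a,s')-\alpha\sum_{s}d(s)\,\mathrm{KL}\big(\pi(\cdot\mid s)\,\|\,\pi_T(\cdot\mid s)\big)$$ subject to, for all $s,a$, $$d(s)=(1-\gamma)\iota(s)+\gamma\sum_{s',a'}p(s',a')\,\tau(s\mid s',a')\ \ge 0,\qquad p(s,a)=d(s)\,\pi(a\mid s),$$ where $\mathrm{KL}(\mu\|\nu)=\sum_a\mu(a)\log\frac{\mu(a)}{\nu(a)}$, with value $+\infty$ if $\mu$ is not absolutely continuous with respect to $\nu$. The nested problem is to maximize $\bar r^{\pi}$ over all policies $\pi$, i.e. over all $\pi$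 with $\pi(a\mid s)\ge0$ and $\sum_a\pi(a\mid s)=1$. Let $v^{\pi}_{\mathrm{ER}}$ be the value function of $\pi$ for the modified reward $r(s,a,s')-\alpha\log\frac{\pi(a\mid s)}{\pi_T(a\mid s)}$, that is, $$v^{\pi}_{\mathrm{ER}}(s)=\mathbb E_{\pi,\tau}\Big[\sum_{t\ge0}\gamma^t\Big(r(s_t,a_t,s_{t+1})-\alpha\log\tfrac{\pi(a_t\mid s_t)}{\pi_T(a_t\mid s_t)}\Big)\,\Big|\,s_0=s\Big],$$ and let $q^{\pi}_{\mathrm{ER}}(s,a)=\sum_{s'}\tau(s'\mid s,a)\big(r(s,a,s')+\gamma\, v^{\pi}_{\mathrm{ER}}(s')\big)$ be its entropy-regularized action-value function. Then the nested problem has an optimal solution, and every optimal solution $\pi^\star$ is a conditional Boltzmann policy with temperature $\alpha$ and energy function $-q^{\pi^\star}_{\mathrm{ER}}(s,a)-\alpha\log\pi_T(a\mid s)$, that is, for all $s$ and $a$, $$\pi^\star(a\mid s)=\frac{\pi_T(a\mid s)\,\exp\big(q^{\pi^\star}_{\mathrm{ER}}(s,a)/\alpha\big)}{\sum_{b}\pi_T(b\mid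 s)\,\exp\big(q^{\pi^\star}_{\mathrm{ER}}(s,b)/\alpha\big)}.$$ -/

import Mathlib

/-- A finite Markov decision process with state space `S` and action space `A`. -/
structure FiniteMDP (S A : Type*) [Fintype S] where
  /-- initial-state distribution `ι(s)` -/
  init : S → ℝ
  /-- transition distribution: `trans s a s'` is `τ(s' | s, a)` -/
  trans : S → A → S → ℝ
  /-- reward `r(s, a, s')` -/
  reward : S → A → S → ℝ
  /-- discount factor -/
  γ : ℝ
  init_mem : init ∈ stdSimplex ℝ S
  trans_mem : ∀ s a, trans s a ∈ stdSimplex ℝ S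
  γ_nonneg : 0 ≤ γ
  γ_lt_one : γ < 1

/-- `π s a` is `π(a | s)`; a policy is a conditional probability distribution over actions. -/
def IsPolicy {S A : Type*} [Fintype A] (π : S → A → ℝ) : Prop :=
  ∀ s, π s ∈ stdSimplex ℝ A

/-- Kullback-Leibler divergence `KL(p ‖ q) = ∑ₐ p(a) log (p(a) / q(a))` of two distributions on a
finite type, with the usual conventions `0 log (0 / q) = 0` and `KL(p ‖ q) = +∞` if `p` is not
absolutely continuous with respect to `q`. -/
noncomputable def finiteKL {A : Type*} [Fintype A] (p q : A → ℝ) : EReal :=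
  open Classical in
  if ∀ a, q a = 0 → p a = 0 then ((∑ a, p a * Real.log (p a / q a) : ℝ) : EReal) else ⊤

namespace FiniteMDP

variable {S A : Type*} [Fintype S] [Fintype A]

/-- Constraints of the policy evaluation dual for the fixed policy `π`, in the variables `d(s)`
and `p(s, a)`. -/
def DualFeasible (M : FiniteMDP S A) (π : S → A → ℝ) (d : S → ℝ) (p : S → A → ℝ) : Prop :=
  (∀ s, d s = (1 - M.γ) * M.init s + M.γ * ∑ s', ∑ a', p s' a' * M.trans s' a' s) ∧
  (∀ s, 0 ≤ d s) ∧
  (∀ s a, p s a = d s * π s a)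

/-- Objective of the entropy-regularized policy evaluation dual:
`E_{(s,a) ∼ p, s' ∼ τ(·|s,a)} [r(s,a,s')] - α E_{s ∼ d} [KL(π(·|s) ‖ πT(·|s))]`.
It is extended-real valued, as the divergence may be `+∞`. -/
noncomputable def erDualObjective (M : FiniteMDP S A) (α : ℝ) (πT π : S → A → ℝ)
    (d : S → ℝ) (p : S → A → ℝ) : EReal :=
  ((∑ s, ∑ a, p s a * ∑ s', M.trans s a s' * M.reward s a s' : ℝ) : EReal)
    - (α : EReal) * ∑ s, (d s : EReal) * finiteKL (π s) (πT s)

/-- Optimal value of the entropy-regularized policy evaluation problem of the policy `π`. -/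
noncomputable def erPolicyValue (M : FiniteMDP S A) (α : ℝ) (πT π : S → A → ℝ) : EReal :=
  sSup {x | ∃ d p, M.DualFeasible π d p ∧ x = M.erDualObjective α πT π d p}

/-- `π` is an optimal solution of the nested problem: policy optimization (outer problem), where
the objective is the optimal value of the entropy-regularized policy evaluation (inner problem). -/
def IsNestedOptimal (M : FiniteMDP S A) (α : ℝ) (πT π : S → A → ℝ) : Prop :=
  IsPolicy π ∧ ∀ π', IsPolicy π' → M.erPolicyValue α πT π' ≤ M.erPolicyValue α πT π

/-- `M.stateProb π s t s'` is the probability of `s_t = s'` given `s_0 = s`, when acting with `π`. -/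
noncomputable def stateProb (M : FiniteMDP S A) (π : S → A → ℝ) (s : S) : ℕ → S → ℝ
  | 0 => fun s' => open Classical in if s' = s then 1 else 0
  | t + 1 => fun s' => ∑ x, M.stateProb π s t x * ∑ a, π x a * M.trans x a s'

/-- Value function of `π` for a reward function `ρ`:
`∑ₜ γᵗ E[ρ(s_t, a_t, s_{t+1}) | s_0 = s]` when acting with `π`. -/
noncomputable def valueFn (M : FiniteMDP S A) (π : S → A → ℝ) (ρ : S → A → S → ℝ) (s : S) : ℝ :=
  ∑' t : ℕ, M.γ ^ t *
    ∑ x, M.stateProb π s t x * ∑ a, π x a * ∑ x', M.trans x a x' * ρ x a x'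

/-- Entropy-regularized reward `r(s, a, s') - α log (π(a|s) / πT(a|s))`. -/
noncomputable def erReward (M : FiniteMDP S A) (α : ℝ) (πT π : S → A → ℝ)
    (s : S) (a : A) (s' : S) : ℝ :=
  M.reward s a s' - α * Real.log (π s a / πT s a)

/-- Entropy-regularized state value function of `π` (meaningful when `π(·|s)` is absolutely
continuous with respect to `πT(·|s)` for all `s`). -/
noncomputable def erV (M : FiniteMDP S A) (α : ℝ) (πT π : S → A → ℝ) : S → ℝ :=
  M.valueFn π (M.erReward α πT π)

/-- Entropy-regularized action-value function of `π`:
`q(s, a) = E_{s' ∼ τ(·|s,a)} [r(s, a, s') + γ v(s')]`, with `v` the entropy-regularized state value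
function. The given first action itself is not penalized. -/
noncomputable def erQ (M : FiniteMDP S A) (α : ℝ) (πT π : S → A → ℝ) (s : S) (a : A) : ℝ :=
  ∑ s', M.trans s a s' * (M.reward s a s' + M.γ * M.erV α πT π s')

end FiniteMDP

/-! Let `v` be the fixed point of the soft Bellman operator, a `γ`-contraction in the sup norm, and
let `β` be the Boltzmann policy built from `v`. By the Gibbs identity (`sum_mul_lookahead_sub`), the
regularized one-step return of any `π ≪ πT` is `v - α KL(π ‖ β)`. Weighting by a feasible `d` and
using the flow constraint turns the objective into `(1 - γ)⟨ι, v⟩ - α ∑ d KL(π ‖ β)`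
(`erDualObjective_eq`). Since `d ≥ (1 - γ) ι > 0`, the maximum is attained exactly at `π = β`; a
policy not absolutely continuous has value `⊥`. Finally `v` is the regularized value of `β`
(`erV_boltzmann`), so the lookahead of `v` is `erQ` of `β`. Uniqueness of `d` is never needed. -/

open Finset

namespace FiniteMDP

/-! ### Gibbs' inequality and its equality case. -/

section Gibbs

variable {A : Type*} [Fintype A]

/-- The summands differ by `b a - p a`, which has total zero. On the right every term is
nonnegative, so the sign and the equality case can be read off termwise. -/
theorem sum_mul_log_div_eq_sum_klFun {p b : A → ℝ} (hp : p ∈ stdSimplex ℝ A)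
    (hb : b ∈ stdSimplex ℝ A) (hac : ∀ a, b a = 0 → p a = 0) :
    ∑ a, p a * Real.log (p a / b a) = ∑ a, b a * InformationTheory.klFun (p a / b a) := by
  have key : ∀ a, b a * InformationTheory.klFun (p a / b a)
      = p a * Real.log (p a / b a) + (b a - p a) := by
    intro a
    by_cases h : b a = 0
    · simp [h, hac a h]
    · rw [InformationTheory.klFun]
      field_simp
      ring
  simp only [key, sum_add_distrib, sum_sub_distrib, hp.2, hb.2, sub_self, add_zero]

theorem sum_mul_log_div_nonneg {p b : A → ℝ} (hp : p ∈ stdSimplex ℝ A)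
    (hb : b ∈ stdSimplex ℝ A) (hac : ∀ a, b a = 0 → p a = 0) :
    0 ≤ ∑ a, p a * Real.log (p a / b a) := by
  rw [sum_mul_log_div_eq_sum_klFun hp hb hac]
  exact sum_nonneg fun a _ => mul_nonneg (hb.1 a)
    (InformationTheory.klFun_nonneg (div_nonneg (hp.1 a) (hb.1 a)))

theorem eq_of_sum_mul_log_div_nonpos {p b : A → ℝ} (hp : p ∈ stdSimplex ℝ A)
    (hb : b ∈ stdSimplex ℝ A) (hac : ∀ a, b a = 0 → p a = 0)
    (h : ∑ a, p a * Real.log (p a / b a) ≤ 0) : p = b := by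
  rw [sum_mul_log_div_eq_sum_klFun hp hb hac] at h
  have hn : ∀ a ∈ univ, 0 ≤ b a * InformationTheory.klFun (p a / b a) := fun a _ =>
    mul_nonneg (hb.1 a) (InformationTheory.klFun_nonneg (div_nonneg (hp.1 a) (hb.1 a)))
  have h0 := (sum_eq_zero_iff_of_nonneg hn).1 (le_antisymm h (sum_nonneg hn))
  funext a
  by_cases hba : b a = 0
  · rw [hba, hac a hba]
  · have h1 := (mul_eq_zero.1 (h0 a (mem_univ a))).resolve_left hba
    rw [InformationTheory.klFun_eq_zero_iff (div_nonneg (hp.1 a) (hb.1 a))] at h1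
    exact (div_eq_one_iff_eq hba).1 h1

end Gibbs

variable {S A : Type*} [Fintype S] [Fintype A]

/-! ### State distributions, policy evaluation and occupancy measures. -/

section StateProb

variable (M : FiniteMDP S A)

theorem stateProb_mem {π : S → A → ℝ} (hπ : IsPolicy π) (s : S) (t : ℕ) :
    M.stateProb π s t ∈ stdSimplex ℝ S := by
  induction t with
  | zero =>
    refine ⟨fun x => ?_, ?_⟩
    · simp only [stateProb]
      split_ifs <;> norm_num
    · classical simp [stateProb]
  | succ t ih =>
    refine ⟨fun x' => ?_, ?_⟩
    · exact sum_nonneg fun x _ => mul_nonneg (ih.1 x) (sum_nonneg fun a _ =>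
        mul_nonneg ((hπ x).1 a) ((M.trans_mem x a).1 x'))
    · simp only [stateProb]
      rw [sum_comm]
      simp_rw [← mul_sum]
      rw [← ih.2]
      refine sum_congr rfl fun x _ => ?_
      rw [sum_comm]
      simp_rw [← mul_sum, (M.trans_mem x _).2, mul_one, (hπ x).2, mul_one]

theorem sum_stateProb_succ_mul (π : S → A → ℝ) (s : S) (t : ℕ) (f : S → ℝ) :
    ∑ x, M.stateProb π s (t + 1) x * f x
      = ∑ x, M.stateProb π s t x * ∑ a, π x a * ∑ x', M.trans x a x' * f x' := by
  simp only [stateProb, sum_mul, mul_sum]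
  rw [sum_comm]
  refine sum_congr rfl fun x _ => ?_
  rw [sum_comm]
  exact sum_congr rfl fun a _ => sum_congr rfl fun x' _ => by ring

theorem summable_pow_mul_sum_stateProb {π : S → A → ℝ} (hπ : IsPolicy π) (s : S) (f : S → ℝ) :
    Summable fun t : ℕ => M.γ ^ t * ∑ x, M.stateProb π s t x * f x := by
  refine Summable.of_norm_bounded
    (g := fun t : ℕ => M.γ ^ t * ∑ x, |f x|)
    ((summable_geometric_of_lt_one M.γ_nonneg M.γ_lt_one).mul_right _) fun t => ?_
  have hmem := M.stateProb_mem hπ s t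
  rw [Real.norm_eq_abs, abs_mul, abs_of_nonneg (pow_nonneg M.γ_nonneg t)]
  refine mul_le_mul_of_nonneg_left ((abs_sum_le_sum_abs _ _).trans (sum_le_sum fun x _ => ?_))
    (pow_nonneg M.γ_nonneg t)
  rw [abs_mul, abs_of_nonneg (hmem.1 x)]
  refine mul_le_of_le_one_left (abs_nonneg _) ?_
  rw [← hmem.2]
  exact single_le_sum (fun y _ => hmem.1 y) (mem_univ x)

/-- A solution of the Bellman equation of `π` is its value function. -/
theorem valueFn_eq_of_bellman {π : S → A → ℝ} (hπ : IsPolicy π) (ρ : S → A → S → ℝ) (v : S → ℝ)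
    (hv : ∀ s, v s = ∑ a, π s a * ∑ x', M.trans s a x' * (ρ s a x' + M.γ * v x')) :
    M.valueFn π ρ = v := by
  funext s
  set F : ℕ → ℝ := fun t => M.γ ^ t * ∑ x, M.stateProb π s t x * v x with hF
  have hsum : Summable F := M.summable_pow_mul_sum_stateProb hπ s v
  -- The Bellman equation makes the series telescope, leaving `F 0 = v s`.
  have hstep : ∀ t, M.γ ^ t *
      ∑ x, M.stateProb π s t x * ∑ a, π x a * ∑ x', M.trans x a x' * ρ x a x'
      = F t - F (t + 1) := by
    intro t
    have hg : ∀ x, ∑ a, π x a * ∑ x', M.trans x a x' * ρ x a x'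
        = v x - M.γ * ∑ a, π x a * ∑ x', M.trans x a x' * v x' := by
      intro x
      rw [eq_sub_iff_add_eq]
      conv_rhs => rw [hv x]
      simp only [mul_sum, ← sum_add_distrib]
      exact sum_congr rfl fun a _ => sum_congr rfl fun x' _ => by ring
    simp only [hF, hg, sum_stateProb_succ_mul, mul_sub, sum_sub_distrib]
    congr 1
    rw [pow_succ, mul_assoc, mul_sum univ _ M.γ]
    congr 1
    exact sum_congr rfl fun x _ => by ring
  have h1 : Summable fun t => F (t + 1) := (summable_nat_add_iff 1).2 hsum
  simp only [valueFn, hstep]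
  rw [hsum.tsum_sub h1, hsum.tsum_eq_zero_add]
  classical simp [hF, stateProb]

/-- The normalized discounted occupancy measure is feasible for the policy evaluation dual. -/
theorem exists_dualFeasible {π : S → A → ℝ} (hπ : IsPolicy π) :
    ∃ d p, M.DualFeasible π d p := by
  classical
  have hs : ∀ s x, Summable fun t : ℕ => M.γ ^ t * M.stateProb π s t x := fun s x => by
    simpa [Pi.single_apply] using M.summable_pow_mul_sum_stateProb hπ s (Pi.single x 1)
  set u : S → S → ℝ := fun s x => ∑' t : ℕ, M.γ ^ t * M.stateProb π s t x with hu
  -- Splitting off `t = 0` from the discounted visit counts gives the flow equation for start state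
  -- `s`; averaging over `ι` then gives the constraint.
  have hrec : ∀ s x', u s x' = (if x' = s then 1 else 0)
      + M.γ * ∑ x, ∑ a, u s x * π x a * M.trans x a x' := by
    intro s x'
    have : ∀ t, M.γ ^ (t + 1) * M.stateProb π s (t + 1) x'
        = ∑ x, (M.γ ^ t * M.stateProb π s t x) * (M.γ * ∑ a, π x a * M.trans x a x') := by
      intro t
      simp only [stateProb, mul_sum univ _ (M.γ ^ (t + 1))]
      exact sum_congr rfl fun x _ => by ring
    rw [hu]
    dsimp only
    rw [(hs s x').tsum_eq_zero_add]
    simp only [this]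
    rw [Summable.tsum_finsetSum fun x _ => (hs s x).mul_right _]
    simp only [tsum_mul_right]
    congr 1
    · simp [stateProb]
    · rw [mul_sum]
      refine sum_congr rfl fun x _ => ?_
      simp only [mul_sum]
      exact sum_congr rfl fun a _ => by ring
  have hu0 : ∀ s x, 0 ≤ u s x := fun s x => tsum_nonneg fun t =>
    mul_nonneg (pow_nonneg M.γ_nonneg t) ((M.stateProb_mem hπ s t).1 x)
  refine ⟨fun x => (1 - M.γ) * ∑ s, M.init s * u s x,
    fun x a => ((1 - M.γ) * ∑ s, M.init s * u s x) * π x a, fun x' => ?_, fun x => ?_,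
    fun x a => rfl⟩
  · have e1 : ∑ s, M.init s * u s x' = M.init x'
        + M.γ * ∑ s, M.init s * ∑ x, ∑ a, u s x * π x a * M.trans x a x' := by
      conv_lhs => enter [2, s]; rw [hrec s x']
      simp only [mul_add, sum_add_distrib, mul_ite, mul_one, mul_zero, sum_ite_eq, mem_univ,
        if_true]
      congr 1
      rw [mul_sum]
      exact sum_congr rfl fun s _ => by ring
    dsimp only
    rw [e1, mul_add]
    congr 1
    rw [mul_left_comm]
    congr 1
    simp only [mul_sum, sum_mul]
    rw [sum_comm]
    refine sum_congr rfl fun x _ => ?_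
    rw [sum_comm]
    exact sum_congr rfl fun a _ => sum_congr rfl fun s _ => by ring
  · exact mul_nonneg (sub_nonneg.2 M.γ_lt_one.le)
      (sum_nonneg fun s _ => mul_nonneg (M.init_mem.1 s) (hu0 s x))

theorem DualFeasible.init_le {M : FiniteMDP S A} {π : S → A → ℝ} (hπ : IsPolicy π) {d : S → ℝ}
    {p : S → A → ℝ} (h : M.DualFeasible π d p) (s : S) : (1 - M.γ) * M.init s ≤ d s := by
  rw [h.1 s]
  refine le_add_of_nonneg_right (mul_nonneg M.γ_nonneg ?_)
  refine sum_nonneg fun x _ => sum_nonneg fun a _ => mul_nonneg ?_ ((M.trans_mem x a).1 s)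
  rw [h.2.2]
  exact mul_nonneg (h.2.1 x) ((hπ x).1 a)

/-- The flow constraint says that the transpose of `I - γ P_π` sends `d` to `(1 - γ) ι`; pair this
with `v`. -/
theorem DualFeasible.sum_mul_sub {M : FiniteMDP S A} {π : S → A → ℝ} {d : S → ℝ}
    {p : S → A → ℝ} (h : M.DualFeasible π d p) (v : S → ℝ) :
    ∑ s, d s * (v s - M.γ * ∑ a, π s a * ∑ s', M.trans s a s' * v s')
      = (1 - M.γ) * ∑ s, M.init s * v s := by
  have e : ∑ s, d s * v s = (1 - M.γ) * ∑ s, M.init s * v s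
      + ∑ s, d s * (M.γ * ∑ a, π s a * ∑ s', M.trans s a s' * v s') := by
    conv_lhs => enter [2, s]; rw [h.1 s, add_mul]
    rw [sum_add_distrib]
    congr 1
    · rw [mul_sum]
      exact sum_congr rfl fun s _ => by ring
    · simp only [mul_sum, sum_mul, h.2.2]
      rw [sum_comm]
      refine sum_congr rfl fun x _ => ?_
      rw [sum_comm]
      exact sum_congr rfl fun a _ => sum_congr rfl fun s _ => by ring
  simp only [mul_sub, sum_sub_distrib]
  linarith

end StateProb

/-! ### Soft Bellman fixed point and optimality of its Boltzmann policy. -/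

section SoftBellman

variable (M : FiniteMDP S A) (α : ℝ) (πT : S → A → ℝ)

/-- One-step lookahead action values for the continuation value `v`. -/
noncomputable def lookahead (v : S → ℝ) (s : S) (a : A) : ℝ :=
  ∑ s', M.trans s a s' * (M.reward s a s' + M.γ * v s')

/-- Partition function of the conditional Boltzmann policy. -/
noncomputable def partitionFn (v : S → ℝ) (s : S) : ℝ :=
  ∑ b, πT s b * Real.exp (M.lookahead v s b / α)

/-- Conditional Boltzmann policy with prior `πT` and continuation value `v`. -/
noncomputable def boltzmann (v : S → ℝ) (s : S) (a : A) : ℝ :=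
  πT s a * Real.exp (M.lookahead v s a / α) / M.partitionFn α πT v s

/-- Soft Bellman optimality operator. -/
noncomputable def softBellman (v : S → ℝ) (s : S) : ℝ :=
  α * Real.log (M.partitionFn α πT v s)

variable {πT}

theorem partitionFn_pos (hπT : IsPolicy πT) (v : S → ℝ) (s : S) :
    0 < M.partitionFn α πT v s := by
  have hnn : ∀ b ∈ univ, 0 ≤ πT s b * Real.exp (M.lookahead v s b / α) := fun b _ =>
    mul_nonneg ((hπT s).1 b) (Real.exp_pos _).le
  refine lt_of_le_of_ne (sum_nonneg hnn) fun h => ?_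
  have h0 := (sum_eq_zero_iff_of_nonneg hnn).1 h.symm
  have h1 : ∑ b, πT s b = 0 := sum_eq_zero fun b hb =>
    (mul_eq_zero.1 (h0 b hb)).resolve_right (Real.exp_ne_zero _)
  rw [(hπT s).2] at h1
  exact one_ne_zero h1

theorem boltzmann_isPolicy (hπT : IsPolicy πT) (v : S → ℝ) : IsPolicy (M.boltzmann α πT v) := by
  intro s
  have hZ := M.partitionFn_pos α hπT v s
  refine ⟨fun a => div_nonneg (mul_nonneg ((hπT s).1 a) (Real.exp_pos _).le) hZ.le, ?_⟩
  simp only [boltzmann]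
  rw [← sum_div]
  exact div_self hZ.ne'

theorem boltzmann_eq_zero_iff (hπT : IsPolicy πT) (v : S → ℝ) (s : S) (a : A) :
    M.boltzmann α πT v s a = 0 ↔ πT s a = 0 := by
  simp [boltzmann, (M.partitionFn_pos α hπT v s).ne', Real.exp_ne_zero]

variable {α}

omit [Fintype A] in
theorem lookahead_le_add (v w : S → ℝ) (s : S) (a : A) :
    M.lookahead v s a ≤ M.lookahead w s a + M.γ * dist v w := by
  have h : M.lookahead w s a + M.γ * dist v w
      = ∑ s', M.trans s a s' * (M.reward s a s' + M.γ * (w s' + dist v w)) := by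
    simp only [lookahead, mul_add, sum_add_distrib, ← sum_mul, (M.trans_mem s a).2, one_mul,
      add_assoc]
  rw [h]
  refine sum_le_sum fun s' _ => mul_le_mul_of_nonneg_left ?_ ((M.trans_mem s a).1 s')
  have h1 := (le_abs_self _).trans ((Real.dist_eq (v s') (w s')).symm.le.trans
    (dist_le_pi_dist v w s'))
  have h2 : v s' ≤ w s' + dist v w := by linarith
  have := mul_le_mul_of_nonneg_left h2 M.γ_nonneg
  linarith

/-- Raising all lookaheads by `c` multiplies the partition function by `exp (c / α)`, hence adds `c`
after `α log`. -/
theorem softBellman_le_add (hα : 0 < α) (hπT : IsPolicy πT) (v w : S → ℝ) (s : S) :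
    M.softBellman α πT v s ≤ M.softBellman α πT w s + M.γ * dist v w := by
  have h : M.partitionFn α πT v s
      ≤ M.partitionFn α πT w s * Real.exp (M.γ * dist v w / α) := by
    rw [partitionFn, partitionFn, sum_mul]
    refine sum_le_sum fun b _ => ?_
    rw [mul_assoc, ← Real.exp_add, ← add_div]
    refine mul_le_mul_of_nonneg_left (Real.exp_le_exp.2 ?_) ((hπT s).1 b)
    exact div_le_div_of_nonneg_right (M.lookahead_le_add v w s b) hα.le
  have hlog := Real.log_le_log (M.partitionFn_pos α hπT v s) h
  rw [Real.log_mul (M.partitionFn_pos α hπT w s).ne' (Real.exp_ne_zero _), Real.log_exp] at hlog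
  have := mul_le_mul_of_nonneg_left hlog hα.le
  rwa [mul_add, mul_div_cancel₀ _ hα.ne'] at this

theorem exists_softBellman_fixedPoint (hα : 0 < α) (hπT : IsPolicy πT) :
    ∃ v, M.softBellman α πT v = v := by
  have hc : ContractingWith ⟨M.γ, M.γ_nonneg⟩ (M.softBellman α πT) := by
    refine ⟨M.γ_lt_one, LipschitzWith.of_dist_le_mul fun v w => ?_⟩
    refine (dist_pi_le_iff (mul_nonneg M.γ_nonneg dist_nonneg)).2 fun s => ?_
    rw [Real.dist_eq, abs_le]
    have h1 := M.softBellman_le_add hα hπT v w s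
    have h2 := M.softBellman_le_add hα hπT w v s
    rw [dist_comm w v] at h2
    change -(M.γ * dist v w) ≤ _ ∧ _
    constructor <;> linarith
  exact ⟨_, hc.fixedPoint_isFixedPt⟩

/-- Gibbs variational identity. -/
theorem sum_mul_lookahead_sub (hα : 0 < α) (hπT : IsPolicy πT) (v : S → ℝ) {π : S → A → ℝ}
    (hπ : IsPolicy π) (s : S) (hac : ∀ a, πT s a = 0 → π s a = 0) :
    ∑ a, π s a * (M.lookahead v s a - α * Real.log (π s a / πT s a))
      = M.softBellman α πT v s
        - α * ∑ a, π s a * Real.log (π s a / M.boltzmann α πT v s a) := by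
  have hZ := (M.partitionFn_pos α hπT v s).ne'
  have key : ∀ a, π s a * (M.lookahead v s a - α * Real.log (π s a / πT s a))
      = π s a * M.softBellman α πT v s
        - α * (π s a * Real.log (π s a / M.boltzmann α πT v s a)) := by
    intro a
    by_cases h : π s a = 0
    · simp [h]
    · have hT : πT s a ≠ 0 := fun h0 => h (hac a h0)
      rw [boltzmann, softBellman, Real.log_div h hT,
        Real.log_div h (div_ne_zero (mul_ne_zero hT (Real.exp_ne_zero _)) hZ),
        Real.log_div (mul_ne_zero hT (Real.exp_ne_zero _)) hZ,
        Real.log_mul hT (Real.exp_ne_zero _), Real.log_exp]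
      field_simp
      ring
  simp only [key, sum_sub_distrib, ← sum_mul, (hπ s).2, one_mul, mul_sum]

/-- At the Boltzmann policy the divergence in the Gibbs identity vanishes, so the fixed-point
equation becomes that policy's Bellman equation. -/
theorem erV_boltzmann (hα : 0 < α) (hπT : IsPolicy πT) {v : S → ℝ}
    (hv : M.softBellman α πT v = v) : M.erV α πT (M.boltzmann α πT v) = v := by
  have hπ := M.boltzmann_isPolicy α hπT v
  refine M.valueFn_eq_of_bellman hπ _ v fun s => ?_
  have h := M.sum_mul_lookahead_sub hα hπT v hπ s
    fun a => (M.boltzmann_eq_zero_iff α hπT v s a).2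
  have h0 : ∑ a, M.boltzmann α πT v s a *
      Real.log (M.boltzmann α πT v s a / M.boltzmann α πT v s a) = 0 :=
    sum_eq_zero fun a _ => by
      by_cases hb : M.boltzmann α πT v s a = 0
      · simp [hb]
      · simp [div_self hb]
  rw [h0, mul_zero, sub_zero, hv] at h
  rw [← h]
  refine sum_congr rfl fun a _ => ?_
  congr 1
  simp only [lookahead, erReward, mul_add, mul_sub, sum_add_distrib, sum_sub_distrib, ← sum_mul,
    (M.trans_mem s a).2]
  ring

theorem erDualObjective_eq (hα : 0 < α) (hπT : IsPolicy πT) {v : S → ℝ}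
    (hv : M.softBellman α πT v = v) {π : S → A → ℝ} (hπ : IsPolicy π)
    (hac : ∀ s a, πT s a = 0 → π s a = 0) {d : S → ℝ} {p : S → A → ℝ}
    (h : M.DualFeasible π d p) :
    M.erDualObjective α πT π d p = (((1 - M.γ) * ∑ s, M.init s * v s - α * ∑ s, d s *
      ∑ a, π s a * Real.log (π s a / M.boltzmann α πT v s a) : ℝ) : EReal) := by
  have hkl : ∀ s, finiteKL (π s) (πT s)
      = ((∑ a, π s a * Real.log (π s a / πT s a) : ℝ) : EReal) := fun s => if_pos (hac s)
  have hcast : ∀ f : S → ℝ, ∑ s, ((f s : ℝ) : EReal) = ((∑ s, f s : ℝ) : EReal) := fun f =>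
    (map_sum (⟨⟨Real.toEReal, EReal.coe_zero⟩, EReal.coe_add⟩ : ℝ →+ EReal) f univ).symm
  simp only [erDualObjective, hkl, ← EReal.coe_mul, hcast, ← EReal.coe_sub]
  congr 1
  rw [← h.sum_mul_sub v]
  simp only [h.2.2]
  rw [mul_sum univ _ α, mul_sum univ _ α, ← sum_sub_distrib, ← sum_sub_distrib]
  refine sum_congr rfl fun s _ => ?_
  have e := M.sum_mul_lookahead_sub hα hπT v hπ s (hac s)
  rw [hv] at e
  have e2 : ∑ a, π s a * (M.lookahead v s a - α * Real.log (π s a / πT s a))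
      = ∑ a, π s a * ∑ s', M.trans s a s' * M.reward s a s'
        + M.γ * ∑ a, π s a * ∑ s', M.trans s a s' * v s'
        - α * ∑ a, π s a * Real.log (π s a / πT s a) := by
    rw [mul_sum univ _ α, mul_sum univ _ M.γ, ← sum_add_distrib, ← sum_sub_distrib]
    refine sum_congr rfl fun a _ => ?_
    have : M.lookahead v s a = ∑ s', M.trans s a s' * M.reward s a s'
        + M.γ * ∑ s', M.trans s a s' * v s' := by
      rw [lookahead, mul_sum, ← sum_add_distrib]
      exact sum_congr rfl fun s' _ => by ring
    rw [this]
    ring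
  have e3 : ∑ a, d s * π s a * ∑ s', M.trans s a s' * M.reward s a s'
      = d s * ∑ a, π s a * ∑ s', M.trans s a s' * M.reward s a s' := by
    rw [mul_sum univ _ (d s)]
    exact sum_congr rfl fun a _ => by ring
  rw [e3]
  linear_combination d s * (e - e2)

theorem erDualObjective_eq_bot (hinit : ∀ s, 0 < M.init s) (hα : 0 < α) {π : S → A → ℝ}
    (hπ : IsPolicy π) (hac : ¬ ∀ s a, πT s a = 0 → π s a = 0) {d : S → ℝ} {p : S → A → ℝ}
    (h : M.DualFeasible π d p) : M.erDualObjective α πT π d p = ⊥ := by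
  classical
  have hd : ∀ s, 0 < d s := fun s =>
    (mul_pos (sub_pos.2 M.γ_lt_one) (hinit s)).trans_le (h.init_le hπ s)
  obtain ⟨s₀, hs₀⟩ := not_forall.1 hac
  -- In `EReal`, `⊤ + ⊥ = ⊥`, so the other summands must be kept away from `⊥`.
  have hbot : ∀ s, (d s : EReal) * finiteKL (π s) (πT s) ≠ ⊥ := by
    intro s
    rw [finiteKL]
    split_ifs
    · rw [← EReal.coe_mul]
      exact EReal.coe_ne_bot _
    · rw [EReal.coe_mul_top_of_pos (hd s)]
      exact top_ne_bot
  have hsum_ne : ∀ T : Finset S, ∑ s ∈ T, (d s : EReal) * finiteKL (π s) (πT s) ≠ ⊥ := by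
    intro T
    induction T using Finset.induction_on with
    | empty => simp
    | insert s T hs ih =>
      rw [sum_insert hs, Ne, EReal.add_eq_bot_iff]
      exact fun h => h.elim (hbot s) ih
  have htop : (d s₀ : EReal) * finiteKL (π s₀) (πT s₀) = ⊤ := by
    rw [finiteKL, if_neg hs₀, EReal.coe_mul_top_of_pos (hd s₀)]
  have hsum : ∑ s, (d s : EReal) * finiteKL (π s) (πT s) = ⊤ := by
    rw [← add_sum_erase _ _ (mem_univ s₀), htop, EReal.top_add_of_ne_bot (hsum_ne _)]
  rw [erDualObjective, hsum, EReal.coe_mul_top_of_pos hα, EReal.sub_top]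

theorem erPolicyValue_le (hα : 0 < α) (hπT : IsPolicy πT) {v : S → ℝ}
    (hv : M.softBellman α πT v = v) {π : S → A → ℝ} (hπ : IsPolicy π)
    (hac : ∀ s a, πT s a = 0 → π s a = 0) :
    M.erPolicyValue α πT π ≤ (((1 - M.γ) * ∑ s, M.init s * v s
      - α * ((1 - M.γ) * ∑ s, M.init s *
        ∑ a, π s a * Real.log (π s a / M.boltzmann α πT v s a)) : ℝ) : EReal) := by
  refine sSup_le ?_
  rintro _ ⟨d, p, h, rfl⟩
  rw [M.erDualObjective_eq hα hπT hv hπ hac h, EReal.coe_le_coe_iff]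
  refine sub_le_sub_left (mul_le_mul_of_nonneg_left ?_ hα.le) _
  rw [mul_sum]
  refine sum_le_sum fun s _ => ?_
  rw [← mul_assoc]
  exact mul_le_mul_of_nonneg_right (h.init_le hπ s) (sum_mul_log_div_nonneg (hπ s)
    (M.boltzmann_isPolicy α hπT v s)
    fun a ha => hac s a ((M.boltzmann_eq_zero_iff α hπT v s a).1 ha))

/-- One feasible point suffices, as the divergence term is zero for every `d`. -/
theorem le_erPolicyValue_boltzmann (hα : 0 < α) (hπT : IsPolicy πT) {v : S → ℝ}
    (hv : M.softBellman α πT v = v) :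
    (((1 - M.γ) * ∑ s, M.init s * v s : ℝ) : EReal)
      ≤ M.erPolicyValue α πT (M.boltzmann α πT v) := by
  have hπ := M.boltzmann_isPolicy α hπT v
  obtain ⟨d, p, h⟩ := M.exists_dualFeasible hπ
  refine le_sSup ⟨d, p, h, ?_⟩
  rw [M.erDualObjective_eq hα hπT hv hπ
    (fun s a => (M.boltzmann_eq_zero_iff α hπT v s a).2) h]
  simp

theorem erPolicyValue_eq_bot (hinit : ∀ s, 0 < M.init s) (hα : 0 < α) {π : S → A → ℝ}
    (hπ : IsPolicy π) (hac : ¬ ∀ s a, πT s a = 0 → π s a = 0) :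
    M.erPolicyValue α πT π = ⊥ := by
  refine le_bot_iff.1 (sSup_le ?_)
  rintro _ ⟨d, p, h, rfl⟩
  exact (M.erDualObjective_eq_bot hinit hα hπ hac h).le

theorem boltzmann_isNestedOptimal (hinit : ∀ s, 0 < M.init s) (hα : 0 < α) (hπT : IsPolicy πT)
    {v : S → ℝ} (hv : M.softBellman α πT v = v) :
    M.IsNestedOptimal α πT (M.boltzmann α πT v) := by
  refine ⟨M.boltzmann_isPolicy α hπT v, fun π hπ => ?_⟩
  by_cases hac : ∀ s a, πT s a = 0 → π s a = 0
  · refine (M.erPolicyValue_le hα hπT hv hπ hac).trans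
      (le_trans ?_ (M.le_erPolicyValue_boltzmann hα hπT hv))
    rw [EReal.coe_le_coe_iff]
    refine sub_le_self _ (mul_nonneg hα.le (mul_nonneg (sub_nonneg.2 M.γ_lt_one.le)
      (sum_nonneg fun s _ => mul_nonneg (hinit s).le (sum_mul_log_div_nonneg (hπ s)
        (M.boltzmann_isPolicy α hπT v s)
        fun a ha => hac s a ((M.boltzmann_eq_zero_iff α hπT v s a).1 ha)))))
  · rw [M.erPolicyValue_eq_bot hinit hα hπ hac]
    exact bot_le

theorem IsNestedOptimal.eq_boltzmann {M : FiniteMDP S A} (hinit : ∀ s, 0 < M.init s)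
    (hα : 0 < α) (hπT : IsPolicy πT) {v : S → ℝ} (hv : M.softBellman α πT v = v)
    {π : S → A → ℝ} (hopt : M.IsNestedOptimal α πT π) : π = M.boltzmann α πT v := by
  obtain ⟨hπ, hmax⟩ := hopt
  have hle := (M.le_erPolicyValue_boltzmann hα hπT hv).trans
    (hmax _ (M.boltzmann_isPolicy α hπT v))
  by_cases hac : ∀ s a, πT s a = 0 → π s a = 0
  · have hac' : ∀ s a, M.boltzmann α πT v s a = 0 → π s a = 0 := fun s a ha =>
      hac s a ((M.boltzmann_eq_zero_iff α hπT v s a).1 ha)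
    have h := hle.trans (M.erPolicyValue_le hα hπT hv hπ hac)
    rw [EReal.coe_le_coe_iff, le_sub_self_iff] at h
    -- Optimality forces the `ι`-weighted divergence sum to be at most zero; as `ι > 0`, every
    -- state's divergence vanishes.
    have h1 := nonpos_of_mul_nonpos_right (nonpos_of_mul_nonpos_right h hα)
      (sub_pos.2 M.γ_lt_one)
    have hnn : ∀ s ∈ univ, 0 ≤ M.init s *
        ∑ a, π s a * Real.log (π s a / M.boltzmann α πT v s a) := fun s _ =>
      mul_nonneg (hinit s).le (sum_mul_log_div_nonneg (hπ s) (M.boltzmann_isPolicy α hπT v s)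
        (hac' s))
    have h2 := (sum_eq_zero_iff_of_nonneg hnn).1 (le_antisymm h1 (sum_nonneg hnn))
    funext s
    exact eq_of_sum_mul_log_div_nonpos (hπ s) (M.boltzmann_isPolicy α hπT v s) (hac' s)
      ((mul_eq_zero.1 (h2 s (mem_univ s))).resolve_left (hinit s).ne').le
  · rw [M.erPolicyValue_eq_bot hinit hα hπ hac] at hle
    exact absurd (le_bot_iff.1 hle) (EReal.coe_ne_bot _)

end SoftBellman

end FiniteMDP

theorem mainTheorem4 {S A : Type*} [Fintype S] [Fintype A] (M : FiniteMDP S A)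
    (hinit : ∀ s, 0 < M.init s) (α : ℝ) (hα : 0 < α)
    (πT : S → A → ℝ) (hπT : IsPolicy πT) :
    (∃ π, M.IsNestedOptimal α πT π) ∧
    ∀ π, M.IsNestedOptimal α πT π → ∀ s a,
      π s a = πT s a * Real.exp (M.erQ α πT π s a / α) /
        ∑ b, πT s b * Real.exp (M.erQ α πT π s b / α) := by
  obtain ⟨v, hv⟩ := M.exists_softBellman_fixedPoint hα hπT
  refine ⟨⟨_, M.boltzmann_isNestedOptimal hinit hα hπT hv⟩, fun π hπ s a => ?_⟩
  obtain rfl := hπ.eq_boltzmann hinit hα hπT hv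
  have hq : M.erQ α πT (M.boltzmann α πT v) = M.lookahead v := by
    funext s a
    rw [FiniteMDP.erQ, M.erV_boltzmann hα hπT hv, FiniteMDP.lookahead]
  rw [hq, FiniteMDP.boltzmann, FiniteMDP.partitionFn]
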